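/- Setting. There are $n$ jobs on one machine, all available at time $0$; an instance $\mathcal I=\{\mathcal D_j\}_{j\in[n]}$ consists of probability distributions on $\mathbb R_{\ge 0}$ with finite support, and the job sizes $P_j\sim\mathcal D_j$ are independent. For $\alpha\ge 1$, a pair $(\mathcal D,\mathcal D')$ of distributions on $\mathbb R_{\ge0}$ is $\alpha$-close if for all $x\ge 0$ $$\tfrac1\alpha\,\mathbb P_{P\sim\mathcal D}(P>\alpha x)\le \mathbb P_{P'\sim\mathcal D'}(P'>x)\le \alpha\,\mathbb P_{P\sim\mathcal D}(P>x/\alpha).$$ For a job $j$ with attained processing time $y$, the quantum of length $q\ge 0$ has rank $$R_j(q,y)=\frac{\mathbb P(P_j-y\le q\mid P_j>y)}{\mathbb E[\min\{P_j-y,q\}\mid P_j>y]}$$ (understood as $0$ if $q=0$). The Gittins quanta $q_{j,1},\dots,q_{j,n_j}>0$ of job $j$ are computed recursively by $y_{j,i}=q_{j,1}+\dots+q_{j,i-1}$, $q_{j,i}\in\arg\max_{q\ge0}R_j(q,y_{j,i})$, and their total length is the largest support point of $\mathcal D_j$ (maximizers may be chosen arbitrarily if they are not unique). The GIPP order lists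 all quanta of all jobs by decreasing rank $R_j(q_{j,i},y_{j,i})$, ties in favor of the lower-indexed job, and quanta of the same job with equal rank in their order $i$. Running a quantum $(j,q)$ means running job $j$ for $q$ time units or until it completes, whichever comes first; a job of size $0$ completes at time $0$. $\mathsf{GIPP}(\mathcal I,\mathcal I)$ is the expected total completion time $\sum_j\mathbb E[C_j]$ on instance $\mathcal I$ when the Gittins quanta of $\mathcal I$ are run one after the other, without idling, in the GIPP order. $\mathsf{RG}(\mathcal I^*,\hat{\mathcal I})$ is the expected total completion time when the job sizes have the distributions of $\mathcal I^*$ and the Gittins quanta of $\hat{\mathcal I}$ are run in the GIPP order of $\hat{\mathcal I}$, each quantum $(j,\hat q_{j,i})$ being run with length $\alpha\,\hat q_{j,i}$ instead of $\hat q_{j,i}$ (an expected total completion time is $\infty$ if with positive probability some job never completes). Theorem. Let $\alpha\ge1$, and let $\mathcal I^*=\{\mathcal D^*_j\}_{j\in[n]}$ (true) and $\hat{\mathcal I}=\{\hat{\mathcal D}_j\}_{j\in[n]}$ (predicted) be instances with finite support such that every pair $(\mathcal D_j^*,\hat{\mathcal D}_j)$ is $\alpha$-close. Then, for every choice of the Gittins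 quanta of $\mathcal I^*$ and of $\hat{\mathcal I}$, $$\mathsf{RG}(\mathcal I^*,\hat{\mathcal I})\le\alpha^6\cdot\mathsf{GIPP}(\mathcal I^*,\mathcal I^*).$$ -/

import Mathlib

open MeasureTheory ProbabilityTheory Set
open scoped ENNReal

noncomputable section

namespace RobustGittins

/-- `D` is a finitely supported probability distribution on the nonnegative reals. -/
structure IsSizeDist (D : Measure ℝ) : Prop where
  isProb : IsProbabilityMeasure D
  nonneg : D (Iio 0) = 0
  finiteSupport : ∃ s : Finset ℝ, D ((s : Set ℝ)ᶜ) = 0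

/-- The pair `(D, D')` is `α`-close: for all `x ≥ 0`,
`(1/α) * P(P > α x) ≤ P(P' > x) ≤ α * P(P > x / α)`, where `P ∼ D` and `P' ∼ D'`. -/
def AlphaClose (α : ℝ) (D D' : Measure ℝ) : Prop :=
  ∀ x : ℝ, 0 ≤ x →
    1 / α * D.real (Ioi (α * x)) ≤ D'.real (Ioi x) ∧
      D'.real (Ioi x) ≤ α * D.real (Ioi (x / α))

/-- Investment `I(q, y) = E[min (P - y) q | P > y]`. -/
def investment (D : Measure ℝ) (q y : ℝ) : ℝ :=
  ∫ x, min (x - y) q ∂(cond D (Ioi y))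

/-- Rank `R(q, y) = P(P - y ≤ q | P > y) / I(q, y)`. -/
def rank (D : Measure ℝ) (q y : ℝ) : ℝ :=
  (cond D (Ioi y)).real {x | x - y ≤ q} / investment D q y

/-- Processing attained by a job before its `i`-th quantum (counting from `0`), when the
quanta of the job have lengths `q`. -/
def attained (q : List ℝ) (i : ℕ) : ℝ := (q.take i).sum

/-- `q` is a list of Gittins quanta of a job with size distribution `D`: each quantum has a
length that maximizes the rank at the processing attained so far, and the quanta add up to the
largest support point of `D`. The maximizers need not be unique; any choice is allowed. -/
structure IsGittinsQuanta (D : Measure ℝ) (q : List ℝ) : Prop where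
  pos : ∀ x ∈ q, 0 < x
  argmax : ∀ (i : ℕ) (hi : i < q.length) (r : ℝ), 0 ≤ r →
    rank D r (attained q i) ≤ rank D q[i] (attained q i)
  total : IsGreatest {x : ℝ | D {x} ≠ 0} q.sum

theorem IsSizeDist.exists_atoms {D : Measure ℝ} (hD : IsSizeDist D) :
    ∃ s : Finset ℝ, (∀ x, x ∈ s ↔ D {x} ≠ 0) ∧ D ((s : Set ℝ)ᶜ) = 0 := by
  classical
  obtain ⟨s, hs⟩ := hD.finiteSupport
  refine ⟨s.filter fun x => D {x} ≠ 0, fun x => ?_, ?_⟩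
  · simp only [Finset.mem_filter, and_iff_right_iff_imp]
    intro hx
    by_contra h
    exact hx (measure_mono_null (by simpa using h) hs)
  · have h2 : D (⋃ x ∈ s.filter fun x => D {x} = 0, {x}) = 0 :=
      (measure_biUnion_null_iff (Finset.countable_toSet _)).2 (by simp)
    refine measure_mono_null ?_ (measure_union_null hs h2)
    intro x hx
    by_cases h : x ∈ s <;> simp_all

theorem IsSizeDist.exists_argmax {D : Measure ℝ} (hD : IsSizeDist D) (s : Finset ℝ)
    (hs : ∀ x, x ∈ s ↔ D {x} ≠ 0) (hs0 : D ((s : Set ℝ)ᶜ) = 0) (y : ℝ)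
    (hy : ∃ a ∈ s, y < a) :
    ∃ a ∈ s, y < a ∧ ∀ r, 0 ≤ r → rank D r y ≤ rank D (a - y) y := by
  classical
  have := hD.isProb
  obtain ⟨M, hMs, hM⟩ := hy
  have hpos : D (Ioi y) ≠ 0 := fun h =>
    (hs M).1 hMs (measure_mono_null (by simpa using hM) h)
  have hν : IsProbabilityMeasure (cond D (Ioi y)) := cond_isProbabilityMeasure hpos
  have hae : ∀ᵐ x ∂(cond D (Ioi y)), x ∈ s ∧ y < x := by
    have h1 : ∀ᵐ x ∂(cond D (Ioi y)), x ∈ (s : Set ℝ) :=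
      (cond_absolutelyContinuous (μ := D) (s := Ioi y)).ae_le hs0
    have h2 : ∀ᵐ x ∂(cond D (Ioi y)), x ∈ Ioi y := ae_cond_mem measurableSet_Ioi
    filter_upwards [h1, h2] with x a b using ⟨by simpa using a, b⟩
  have hint : ∀ r, Integrable (fun x => min (x - y) r) (cond D (Ioi y)) := by
    intro r
    refine Integrable.of_bound (by fun_prop) (∑ a ∈ s, |min (a - y) r|) ?_
    filter_upwards [hae] with x hx
    exact Finset.single_le_sum (f := fun a => |min (a - y) r|) (fun _ _ => abs_nonneg _) hx.1
  have hnn : ∀ r, 0 ≤ r → 0 ≤ rank D r y := by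
    intro r hr
    refine div_nonneg measureReal_nonneg (integral_nonneg_of_ae ?_)
    filter_upwards [hae] with x hx
    exact le_min (sub_nonneg.2 hx.2.le) hr
  have hdom : ∀ r, 0 ≤ r → ∃ a ∈ s.filter (fun a => y < a),
      rank D r y ≤ rank D (a - y) y := by
    intro r hr
    by_cases hne : (s.filter fun a => y < a ∧ a - y ≤ r).Nonempty
    · obtain ⟨a, ha, hmax⟩ := Finset.exists_max_image _ id hne
      simp only [Finset.mem_filter, id] at ha hmax
      refine ⟨a, by simp [ha.1, ha.2.1], ?_⟩
      have hnum : (cond D (Ioi y)).real {x | x - y ≤ r}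
          = (cond D (Ioi y)).real {x | x - y ≤ a - y} := by
        refine measureReal_congr ?_
        filter_upwards [hae] with x hx
        refine propext ⟨fun h => ?_, fun h => ?_⟩
        · have := hmax x ⟨hx.1, hx.2, h⟩
          change x - y ≤ a - y
          linarith
        · change x - y ≤ r
          have h' : x - y ≤ a - y := h
          linarith [ha.2.2]
      have hden : investment D (a - y) y ≤ investment D r y :=
        integral_mono (hint _) (hint _) fun x => min_le_min le_rfl ha.2.2
      have hdpos : 0 < investment D (a - y) y := by
        have hp : ∀ᵐ x ∂(cond D (Ioi y)), 0 < min (x - y) (a - y) := by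
          filter_upwards [hae] with x hx
          exact lt_min (by linarith [hx.2]) (by linarith [ha.2.1])
        refine (integral_pos_iff_support_of_nonneg_ae (hp.mono fun x h => h.le) (hint _)).2 ?_
        refine pos_iff_ne_zero.2 fun h0 => ?_
        have hF : ∀ᵐ x ∂(cond D (Ioi y)), False := by
          filter_upwards [hp, measure_eq_zero_iff_ae_notMem.1 h0] with x h1 h2
          exact h2 h1.ne'
        exact hpos (by simpa using hF)
      unfold rank
      rw [hnum]
      exact div_le_div_of_nonneg_left measureReal_nonneg hdpos hden
    · refine ⟨M, by simp [hMs, hM], ?_⟩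
      have h0 : (cond D (Ioi y)).real {x | x - y ≤ r} = 0 := by
        rw [measureReal_eq_zero_iff]
        refine measure_mono_null ?_ hae
        intro x hx hx'
        exact hne ⟨x, Finset.mem_filter.2 ⟨hx'.1, hx'.2, hx⟩⟩
      have : rank D r y = 0 := by rw [rank, h0, zero_div]
      rw [this]
      exact hnn _ (by linarith)
  obtain ⟨a, ha, hmax⟩ := Finset.exists_max_image (s.filter fun a => y < a)
    (fun a => rank D (a - y) y) ⟨M, by simp [hMs, hM]⟩
  simp only [Finset.mem_filter] at ha
  refine ⟨a, ha.1, ha.2, fun r hr => ?_⟩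
  obtain ⟨b, hb, hrb⟩ := hdom r hr
  exact hrb.trans (hmax b hb)

/-- Every finitely supported distribution has a list of Gittins quanta. -/
theorem IsSizeDist.exists_isGittinsQuanta {D : Measure ℝ} (hD : IsSizeDist D) :
    ∃ q, IsGittinsQuanta D q := by
  classical
  have := hD.isProb
  obtain ⟨s, hs, hs0⟩ := hD.exists_atoms
  have hne : s.Nonempty := by
    by_contra h
    rw [Finset.not_nonempty_iff_eq_empty] at h
    simp [h] at hs0
  obtain ⟨M, hMs, hM⟩ := Finset.exists_max_image s id hne
  simp only [id] at hM
  have hM0 : 0 ≤ M := by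
    by_contra h
    exact (hs M).1 hMs (measure_mono_null (by simpa using h) hD.nonneg)
  have key : ∀ (k : ℕ) (y : ℝ), y ≤ M → (s.filter fun a => y < a).card = k →
      ∃ q : List ℝ, (∀ x ∈ q, 0 < x) ∧ (∀ (i : ℕ) (hi : i < q.length) (r : ℝ), 0 ≤ r →
        rank D r (y + attained q i) ≤ rank D q[i] (y + attained q i)) ∧ y + q.sum = M := by
    intro k
    induction k using Nat.strong_induction_on with
    | _ k ih =>
      intro y hyM hk
      rcases hyM.eq_or_lt with rfl | hlt
      · exact ⟨[], by simp, by simp, by simp⟩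
      · obtain ⟨a, ha, hya, hmax⟩ := hD.exists_argmax s hs hs0 y ⟨M, hMs, hlt⟩
        obtain ⟨q, hq1, hq2, hq3⟩ := ih _ (by
          rw [← hk]
          refine Finset.card_lt_card ?_
          rw [Finset.ssubset_iff_of_subset]
          · exact ⟨a, by simp [ha, hya], by simp⟩
          · intro x hx
            simp only [Finset.mem_filter] at hx ⊢
            exact ⟨hx.1, hya.trans hx.2⟩) a (hM a ha) rfl
        refine ⟨(a - y) :: q, ?_, ?_, ?_⟩
        · simpa [hya] using hq1
        · intro i hi r hr
          cases i with
          | zero => simpa [attained] using hmax r hr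
          | succ i =>
            have h := hq2 i (by simpa using hi) r hr
            have e : y + attained ((a - y) :: q) (i + 1) = a + attained q i := by
              simp [attained]; ring
            rw [e]
            simpa using h
        · simp only [List.sum_cons]; linarith
  obtain ⟨q, h1, h2, h3⟩ := key _ 0 hM0 rfl
  refine ⟨q, h1, by simpa using h2, ?_⟩
  simp only [zero_add] at h3
  rw [h3]
  exact ⟨(hs M).1 hMs, fun x hx => hM x ((hs x).2 hx)⟩

/-- All pairs `(j, i)`, standing for the `i`-th quantum of job `j`. -/
def quantaIndices {n : ℕ} (Q : Fin n → List ℝ) : List (Fin n × ℕ) :=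
  (List.finRange n).flatMap fun j => (List.range (Q j).length).map fun i => (j, i)

/-- Length of the `i`-th quantum of job `j`. -/
def quantumLength {n : ℕ} (Q : Fin n → List ℝ) (a : Fin n × ℕ) : ℝ := (Q a.1).getD a.2 0

/-- Rank of the `i`-th quantum of job `j`. -/
def quantumRank {n : ℕ} (D : Fin n → Measure ℝ) (Q : Fin n → List ℝ) (a : Fin n × ℕ) : ℝ :=
  rank (D a.1) (quantumLength Q a) (attained (Q a.1) a.2)

/-- Decreasing order of rank, ties in favor of the job with the lower index; quanta of the same
job with equal rank keep their order. -/
def gippLE {n : ℕ} (D : Fin n → Measure ℝ) (Q : Fin n → List ℝ) (a b : Fin n × ℕ) : Prop :=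
  quantumRank D Q b < quantumRank D Q a ∨
    (quantumRank D Q a = quantumRank D Q b ∧ (a.1 < b.1 ∨ (a.1 = b.1 ∧ a.2 ≤ b.2)))

open Classical in
/-- The GIPP order of the quanta `Q` of the instance `D`. -/
def gippOrder {n : ℕ} (D : Fin n → Measure ℝ) (Q : Fin n → List ℝ) : List (Fin n × ℕ) :=
  (quantaIndices Q).insertionSort (gippLE D Q)

/-- The list of scheduling decisions (job, length) that runs the quanta `Q` of the instance `D`
in the GIPP order, each one stretched by the factor `c`. -/
def gippSchedule {n : ℕ} (c : ℝ) (D : Fin n → Measure ℝ) (Q : Fin n → List ℝ) :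
    List (Fin n × ℝ) :=
  (gippOrder D Q).map fun a => (a.1, c * quantumLength Q a)

/-- Time until job `j` is complete if the jobs have sizes `p` and attained processing times `y`,
and the scheduling decisions in the list are executed one after the other without idling.
The decision `(k, q)` runs job `k` for `q` time units or until it completes, so it takes
`min (p k - y k) q` time units. The value is `∞` if job `j` never completes. -/
def timeToComplete {n : ℕ} (p : Fin n → ℝ) (j : Fin n) :
    List (Fin n × ℝ) → (Fin n → ℝ) → ℝ≥0∞
  | [], y => if p j ≤ y j then 0 else ⊤
  | (k, q) :: S, y =>
      if p j ≤ y j then 0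
      else ENNReal.ofReal (min (p k - y k) q) +
        timeToComplete p j S (Function.update y k (y k + min (p k - y k) q))

/-- Completion time of job `j` when the jobs have sizes `p`. -/
def completionTime {n : ℕ} (p : Fin n → ℝ) (S : List (Fin n × ℝ)) (j : Fin n) : ℝ≥0∞ :=
  timeToComplete p j S fun _ => 0

/-- Expected total completion time of the schedule `S` when the job sizes are independent with
distributions `D j`. -/
def expectedCost {n : ℕ} (D : Fin n → Measure ℝ) (S : List (Fin n × ℝ)) : ℝ≥0∞ :=
  ∫⁻ p, ∑ j, completionTime p S j ∂(Measure.pi D)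

/-- Expected cost of the Gittins policy with predicted instance `Dpred` (with quanta `Q`) when
`Dtrue` is the true instance. -/
def GIPP {n : ℕ} (Dtrue Dpred : Fin n → Measure ℝ) (Q : Fin n → List ℝ) : ℝ≥0∞ :=
  expectedCost Dtrue (gippSchedule 1 Dpred Q)

/-- Expected cost of the Robust Gittins policy with parameter `α` and predicted instance `Dpred`
(with quanta `Q`) when `Dtrue` is the true instance. -/
def RG {n : ℕ} (α : ℝ) (Dtrue Dpred : Fin n → Measure ℝ) (Q : Fin n → List ℝ) : ℝ≥0∞ :=
  expectedCost Dtrue (gippSchedule α Dpred Q)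

end RobustGittins

end

/-! Both policies execute a fixed list of decisions, so their state is deterministic: job `j` has
been run up to `t j` or has completed. By independence, a decision on job `k` costs the expected
work it does (an increment of `trunc`) times one plus the survival probabilities of the other jobs.
Summing gives `planCost` (`lintegral_timeToComplete`).

In this form closeness acts term by term: survival probabilities lose a factor `α` and work
increments a factor `α ^ 2`, so a stretched list on one instance costs at most `α ^ 3` times the
original list on the other (`planCost_stretch_le`). Closeness is symmetric, which allows two such
comparisons: from the true to the predicted instance with the predicted quanta, and back with the
true quanta. In between, on the predicted instance, the predicted Gittins list is compared with the
stretched true one, using that Gittins is optimal among lists that complete all jobs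
(`planCost_gippSchedule_le`).

Optimality comes from `potential`: the work left, plus, for every two quanta of different jobs, the
smaller rank times the product of the work left in both. Rank is completion probability per unit of
expected work, so the sum of rank times work left over the quanta of a job is at most its survival
probability, with equality at quantum boundaries. Bounding the minimum by the rank of the waiting
job shows that no decision lowers the potential by more than its cost (`potential_le_planCost`). In
decreasing order of rank that minimum is the rank of the waiting job, so each cost is covered by the
drop (`planCost_le_potential`). -/

noncomputable section

namespace RobustGittins

/-! ### Survival function, truncated mean and closeness of one distribution. -/

section SizeDist

/-- Survival function `P(P > t)`. -/
def surv (D : Measure ℝ) (t : ℝ) : ℝ := D.real (Ioi t)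

/-- Expected processing `E[min P t]` spent on a job that is run up to attained processing `t`. -/
def trunc (D : Measure ℝ) (t : ℝ) : ℝ := ∫ x, min x t ∂D

variable {D D' : Measure ℝ}

lemma surv_nonneg (D : Measure ℝ) (t : ℝ) : 0 ≤ surv D t := measureReal_nonneg

lemma IsSizeDist.surv_antitone (hD : IsSizeDist D) : Antitone (surv D) := fun _ _ h => by
  have := hD.isProb
  exact measureReal_mono (Ioi_subset_Ioi h)

lemma IsSizeDist.ae_nonneg (hD : IsSizeDist D) : ∀ᵐ x ∂D, 0 ≤ x := by
  rw [ae_iff]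
  convert hD.nonneg using 2
  ext x
  simp

lemma IsSizeDist.integrable_min (hD : IsSizeDist D) (t : ℝ) :
    Integrable (fun x => min x t) D := by
  have := hD.isProb
  refine Integrable.of_bound (by fun_prop) |t| ?_
  filter_upwards [hD.ae_nonneg] with x hx
  rw [Real.norm_eq_abs, abs_le]
  exact ⟨le_min ((neg_nonpos.2 (abs_nonneg t)).trans hx) (neg_abs_le t),
    (min_le_right _ _).trans (le_abs_self t)⟩

lemma IsSizeDist.trunc_sub (hD : IsSizeDist D) (a b : ℝ) :
    trunc D b - trunc D a = ∫ x, (min x b - min x a) ∂D :=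
  (integral_sub (hD.integrable_min b) (hD.integrable_min a)).symm

lemma IsSizeDist.trunc_mono (hD : IsSizeDist D) : Monotone (trunc D) := fun _ _ h =>
  integral_mono (hD.integrable_min _) (hD.integrable_min _) fun _ => min_le_min le_rfl h

lemma IsSizeDist.trunc_lt (hD : IsSizeDist D) {a b : ℝ} (hab : a < b) (ha : surv D a ≠ 0) :
    trunc D a < trunc D b := by
  have := hD.isProb
  rw [← sub_pos, hD.trunc_sub]
  refine (integral_pos_iff_support_of_nonneg
    (fun x => sub_nonneg.2 (min_le_min le_rfl hab.le))
    ((hD.integrable_min b).sub (hD.integrable_min a))).2 ?_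
  have h : 0 < D (Ioi a) := by
    rw [pos_iff_ne_zero]
    intro h
    exact ha (by simp [surv, measureReal_def, h])
  refine h.trans_le (measure_mono fun x hx => ?_)
  have hx : a < x := hx
  rw [Function.mem_support, min_eq_right hx.le]
  exact (sub_pos.2 (lt_min hx hab)).ne'

lemma IsSizeDist.trunc_eq_of_surv_eq_zero (hD : IsSizeDist D) {a b : ℝ} (hab : a ≤ b)
    (ha : surv D a = 0) : trunc D b = trunc D a := by
  have := hD.isProb
  refine integral_congr_ae ?_
  have h : D (Ioi a) = 0 := by rwa [surv, measureReal_eq_zero_iff] at ha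
  filter_upwards [measure_eq_zero_iff_ae_notMem.1 h] with x hx
  have hx : x ≤ a := not_lt.1 hx
  rw [min_eq_left hx, min_eq_left (hx.trans hab)]

lemma IsSizeDist.investment_eq (hD : IsSizeDist D) {r y : ℝ} (hr : 0 ≤ r) :
    investment D r y = (surv D y)⁻¹ * (trunc D (y + r) - trunc D y) := by
  have := hD.isProb
  rw [investment, ProbabilityTheory.cond, integral_smul_measure, hD.trunc_sub, ← integral_indicator measurableSet_Ioi,
    ENNReal.toReal_inv, smul_eq_mul]
  congr 2
  funext x
  by_cases hx : y < x
  · rw [indicator_of_mem (show x ∈ Ioi y from hx), min_eq_right hx.le, ← min_sub_sub_right,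
      add_sub_cancel_left]
  · rw [indicator_of_notMem (show x ∉ Ioi y from hx), min_eq_left (not_lt.1 hx),
      min_eq_left (by linarith [not_lt.1 hx]), sub_self]

/-- The normalization by `surv D y` cancels, so maximality of a rank becomes an inequality between
increments of `surv` and `trunc`. -/
lemma IsSizeDist.rank_eq (hD : IsSizeDist D) {r y : ℝ} (hr : 0 ≤ r) (hy : surv D y ≠ 0) :
    rank D r y = (surv D y - surv D (y + r)) / (trunc D (y + r) - trunc D y) := by
  have := hD.isProb
  have h : (cond D (Ioi y)).real {x | x - y ≤ r} =
      (surv D y)⁻¹ * (surv D y - surv D (y + r)) := by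
    rw [measureReal_def, cond_apply measurableSet_Ioi, ENNReal.toReal_mul, ENNReal.toReal_inv,
      ← measureReal_def, ← measureReal_def]
    congr 1
    rw [surv, surv, ← measureReal_sdiff (Ioi_subset_Ioi (by linarith)) measurableSet_Ioi]
    congr 1
    ext x
    simp [add_comm r y]
  rw [rank, h, hD.investment_eq hr, mul_div_mul_left _ _ (inv_ne_zero hy)]

lemma AlphaClose.surv_le {α : ℝ} (hα : 1 ≤ α) (h : AlphaClose α D D') {x : ℝ} (hx : 0 ≤ x) :
    surv D (α * x) ≤ α * surv D' x := by
  have h1 := (h x hx).1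
  have h0 : 0 < α := by linarith
  rw [one_div, inv_mul_le_iff₀ h0] at h1
  exact h1

lemma AlphaClose.symm {α : ℝ} (hα : 1 ≤ α) (h : AlphaClose α D D') : AlphaClose α D' D := by
  have h0 : 0 < α := by linarith
  intro x hx
  constructor
  · have := (h (α * x) (by positivity)).2
    rw [mul_div_cancel_left₀ _ h0.ne'] at this
    rwa [one_div, inv_mul_le_iff₀ h0]
  · have := h.surv_le hα (x := x / α) (by positivity)
    rwa [mul_div_cancel₀ _ h0.ne'] at this

/-- Layer-cake argument. One factor `α` comes from rescaling the integrand, the other from comparing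
the tails at `α * (a + t)` and `a + t`. -/
lemma AlphaClose.trunc_sub_le {α : ℝ} (hα : 1 ≤ α) (hD : IsSizeDist D) (hD' : IsSizeDist D')
    (h : AlphaClose α D D') {a b : ℝ} (ha : 0 ≤ a) (hab : a ≤ b) :
    trunc D (α * b) - trunc D (α * a) ≤ α ^ 2 * (trunc D' b - trunc D' a) := by
  have := hD.isProb
  have := hD'.isProb
  have h0 : 0 < α := by linarith
  set f : ℝ → ℝ := fun x => min x b - min x a with hf
  have hf0 : ∀ x, 0 ≤ f x := fun x => sub_nonneg.2 (min_le_min le_rfl hab)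
  have hlt : ∀ x t, 0 < t → (t < f x ↔ a + t < x ∧ t < b - a) := by
    intro x t ht
    simp only [hf]
    rcases le_total x a with h1 | h1
    · rw [min_eq_left h1, min_eq_left (h1.trans hab), sub_self]
      exact ⟨fun h => absurd h ht.not_gt, fun h => by linarith [h.1]⟩
    · rw [min_eq_right h1, lt_sub_iff_add_lt, lt_min_iff, add_comm t a, lt_sub_iff_add_lt,
        add_comm t a]
  have hscale : ∀ x, min x (α * b) - min x (α * a) = α * f (x / α) := by
    intro x
    simp only [hf]
    rw [mul_sub, mul_min_of_nonneg _ _ h0.le, mul_min_of_nonneg _ _ h0.le,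
      mul_div_cancel₀ _ h0.ne']
  have hint : Integrable f D' := (hD'.integrable_min b).sub (hD'.integrable_min a)
  have hlint : ∫⁻ x, ENNReal.ofReal (f (x / α)) ∂D ≤
      ENNReal.ofReal α * ∫⁻ x, ENNReal.ofReal (f x) ∂D' := by
    rw [lintegral_eq_lintegral_meas_lt _ (ae_of_all _ fun x => hf0 (x / α))
        (by simp only [hf]; fun_prop),
      lintegral_eq_lintegral_meas_lt _ (ae_of_all _ hf0) (by simp only [hf]; fun_prop),
      ← lintegral_const_mul' _ _ ENNReal.ofReal_ne_top]
    refine setLIntegral_mono' measurableSet_Ioi fun t ht => ?_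
    have ht : 0 < t := ht
    by_cases htb : t < b - a
    · have e1 : {x | t < f (x / α)} = Ioi (α * (a + t)) := by
        ext x
        simp [hlt _ t ht, htb, lt_div_iff₀ h0, mul_comm]
      have e2 : {x | t < f x} = Ioi (a + t) := by
        ext x
        simp [hlt _ t ht, htb]
      have := h.surv_le hα (x := a + t) (by positivity)
      rw [e1, e2, ← ofReal_measureReal, ← ofReal_measureReal, ← ENNReal.ofReal_mul h0.le]
      exact ENNReal.ofReal_le_ofReal this
    · have e1 : {x | t < f (x / α)} = ∅ := by
        ext x
        simp [hlt _ t ht, htb]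
      simp [e1]
  rw [hD.trunc_sub, hD'.trunc_sub]
  simp_rw [hscale]
  rw [integral_const_mul, sq, mul_assoc]
  refine mul_le_mul_of_nonneg_left ?_ h0.le
  rw [integral_eq_lintegral_of_nonneg_ae (ae_of_all _ fun x => hf0 (x / α))
      (by simp only [hf]; fun_prop),
    integral_eq_lintegral_of_nonneg_ae (ae_of_all _ hf0) (by simp only [hf]; fun_prop)]
  refine (ENNReal.toReal_mono ?_ hlint).trans_eq ?_
  · exact ENNReal.mul_ne_top ENNReal.ofReal_ne_top
      hint.lintegral_lt_top.ne
  · rw [ENNReal.toReal_mul, ENNReal.toReal_ofReal h0.le]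

end SizeDist

/-! ### Expected cost of a fixed list of decisions. -/

section Schedules

variable {n : ℕ} {D : Fin n → Measure ℝ}

/-- Expected total completion time of the scheduling decisions in the list, when job `j` has
been run up to attained processing `t j` (or completion) before. -/
def planCost (D : Fin n → Measure ℝ) : List (Fin n × ℝ) → (Fin n → ℝ) → ℝ
  | [], _ => 0
  | (k, q) :: S, t =>
      (trunc (D k) (t k + q) - trunc (D k) (t k)) *
          (1 + ∑ j ∈ Finset.univ.erase k, surv (D j) (t j)) +
        planCost D S (Function.update t k (t k + q))

/-- Total length of the scheduling decisions for job `j`. -/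
def plannedTotal (S : List (Fin n × ℝ)) (j : Fin n) : ℝ :=
  (S.map fun a => if a.1 = j then a.2 else 0).sum

lemma update_add_plannedTotal (k : Fin n) (q : ℝ) (S : List (Fin n × ℝ)) (t : Fin n → ℝ)
    (j : Fin n) : Function.update t k (t k + q) j + plannedTotal S j =
      t j + plannedTotal ((k, q) :: S) j := by
  rcases eq_or_ne j k with rfl | h
  · simp [plannedTotal, add_assoc]
  · simp [plannedTotal, h, h.symm]

lemma planCost_nonneg (hD : ∀ j, IsSizeDist (D j)) :
    ∀ (S : List (Fin n × ℝ)) (t : Fin n → ℝ), (∀ a ∈ S, 0 ≤ a.2) → 0 ≤ planCost D S t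
  | [], _, _ => le_rfl
  | (k, q) :: S, t, hS => by
    rw [List.forall_mem_cons] at hS
    refine add_nonneg (mul_nonneg ?_ ?_) (planCost_nonneg hD S _ hS.2)
    · exact sub_nonneg.2 ((hD k).trunc_mono (by linarith [hS.1]))
    · exact add_nonneg zero_le_one (Finset.sum_nonneg fun _ _ => surv_nonneg _ _)

lemma timeToComplete_eq_zero {p y : Fin n → ℝ} {j : Fin n} (S : List (Fin n × ℝ))
    (h : p j ≤ y j) : timeToComplete p j S y = 0 := by
  rcases S with _ | ⟨⟨k, q⟩, S⟩ <;> simp [timeToComplete, h]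

/-- The attained processing always has the form `min (p i) (t i)` with deterministic `t`. This form
is preserved by a decision, which delays `j` exactly when `p j > t j`. -/
lemma timeToComplete_cons_min {k : Fin n} {q : ℝ} (hq : 0 ≤ q) (S : List (Fin n × ℝ))
    (p t : Fin n → ℝ) (j : Fin n) :
    timeToComplete p j ((k, q) :: S) (fun i => min (p i) (t i)) =
      (Ioi (t j)).indicator 1 (p j) * ENNReal.ofReal (min (p k) (t k + q) - min (p k) (t k)) +
        timeToComplete p j S (fun i => min (p i) (Function.update t k (t k + q) i)) := by
  have hk : min (p k - min (p k) (t k)) q = min (p k) (t k + q) - min (p k) (t k) := by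
    rcases le_total (p k) (t k) with h | h
    · rw [min_eq_left h, min_eq_left (by linarith : p k ≤ t k + q), sub_self, min_eq_left hq]
    · rw [min_eq_right h, ← min_sub_sub_right, add_sub_cancel_left]
  have hu : Function.update (fun i => min (p i) (t i)) k
      (min (p k) (t k) + (min (p k) (t k + q) - min (p k) (t k))) =
      fun i => min (p i) (Function.update t k (t k + q) i) := by
    funext i
    rcases eq_or_ne i k with rfl | h
    · simp
    · simp [h]
  by_cases hj : p j ≤ t j
  · have hle : t j ≤ Function.update t k (t k + q) j := by
      rcases eq_or_ne j k with rfl | h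
      · simpa using hq
      · simp [h]
    rw [timeToComplete_eq_zero _ (le_min le_rfl hj),
      timeToComplete_eq_zero _ (le_min le_rfl (hj.trans hle))]
    simp [hj]
  · have hj' : ¬ p j ≤ min (p j) (t j) := fun h => hj (h.trans (min_le_right _ _))
    simp only [timeToComplete, if_neg hj', hk, hu]
    rw [indicator_of_mem (show p j ∈ Ioi (t j) from not_le.1 hj)]
    simp

lemma IsSizeDist.lintegral_min_sub {D : Measure ℝ} (hD : IsSizeDist D) {a b : ℝ} (hab : a ≤ b) :
    ∫⁻ x, ENNReal.ofReal (min x b - min x a) ∂D = ENNReal.ofReal (trunc D b - trunc D a) := by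
  rw [hD.trunc_sub]
  exact (ofReal_integral_eq_lintegral_ofReal ((hD.integrable_min b).sub (hD.integrable_min a))
    (ae_of_all _ fun x => sub_nonneg.2 (min_le_min le_rfl hab))).symm

/-- For `j ≠ k` the factors are independent. For `j = k` the indicator is redundant, since the work
on `k` vanishes when `p k ≤ t k`; hence the factor `1`. -/
lemma lintegral_indicator_mul_min_sub (hD : ∀ j, IsSizeDist (D j)) (t : Fin n → ℝ)
    (j k : Fin n) {q : ℝ} (hq : 0 ≤ q) :
    ∫⁻ p, (Ioi (t j)).indicator 1 (p j) *
        ENNReal.ofReal (min (p k) (t k + q) - min (p k) (t k)) ∂(Measure.pi D) =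
      ENNReal.ofReal ((if j = k then 1 else surv (D j) (t j)) *
        (trunc (D k) (t k + q) - trunc (D k) (t k))) := by
  have := fun j => (hD j).isProb
  have hf : Measurable fun x : ℝ => (Ioi (t j)).indicator (1 : ℝ → ℝ≥0∞) x :=
    measurable_one.indicator measurableSet_Ioi
  have hg : Measurable fun x : ℝ => ENNReal.ofReal (min x (t k + q) - min x (t k)) := by fun_prop
  have hgk : ∫⁻ p : Fin n → ℝ, ENNReal.ofReal (min (p k) (t k + q) - min (p k) (t k))
      ∂(Measure.pi D) = ENNReal.ofReal (trunc (D k) (t k + q) - trunc (D k) (t k)) := by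
    rw [← (hD k).lintegral_min_sub (by linarith),
      ← (measurePreserving_eval D k).lintegral_comp hg]
  split_ifs with h
  · subst h
    rw [one_mul, ← hgk]
    congr 1
    funext p
    by_cases hp : t j < p j
    · simp [hp]
    · rw [min_eq_left (not_lt.1 hp), min_eq_left (by linarith [not_lt.1 hp])]
      simp
  · have hfj : ∫⁻ p : Fin n → ℝ, (Ioi (t j)).indicator 1 (p j) ∂(Measure.pi D) =
        ENNReal.ofReal (surv (D j) (t j)) := by
      have := (measurePreserving_eval D j).lintegral_comp hf
      refine this.trans ?_
      rw [lintegral_indicator_one measurableSet_Ioi, surv, ofReal_measureReal]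
    have hind : IndepFun (fun p : Fin n → ℝ => p j) (fun p => p k) (Measure.pi D) :=
      (iIndepFun_pi (μ := D) (X := fun _ x => x) fun _ => aemeasurable_id).indepFun h
    rw [ENNReal.ofReal_mul (surv_nonneg _ _), ← hfj, ← hgk]
    exact lintegral_mul_eq_lintegral_mul_lintegral_of_indepFun''
      (hf.comp (measurable_pi_apply j)).aemeasurable
      (hg.comp (measurable_pi_apply k)).aemeasurable (hind.comp hf hg)

/-- The assumption on `plannedTotal` makes every job complete almost surely, which excludes the
value `∞` at the end of the list. -/
theorem lintegral_timeToComplete (hD : ∀ j, IsSizeDist (D j)) :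
    ∀ (S : List (Fin n × ℝ)) (t : Fin n → ℝ), (∀ a ∈ S, 0 ≤ a.2) →
      (∀ j, surv (D j) (t j + plannedTotal S j) = 0) →
      ∫⁻ p, ∑ j, timeToComplete p j S (fun i => min (p i) (t i)) ∂(Measure.pi D) =
        ENNReal.ofReal (planCost D S t)
  | [], t, _, hS => by
    have := fun j => (hD j).isProb
    have h : ∀ᵐ p ∂(Measure.pi D), ∀ j, p j ≤ t j := by
      rw [ae_all_iff]
      intro j
      have h0 : D j (Ioi (t j)) = 0 := by
        have := hS j
        rwa [plannedTotal, List.map_nil, List.sum_nil, add_zero, surv,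
          measureReal_eq_zero_iff] at this
      filter_upwards [(measurePreserving_eval D j).quasiMeasurePreserving.ae
        (measure_eq_zero_iff_ae_notMem.1 h0)] with p hp using not_lt.1 hp
    rw [planCost, ENNReal.ofReal_zero, ← lintegral_zero (μ := Measure.pi D)]
    refine lintegral_congr_ae ?_
    filter_upwards [h] with p hp
    exact Finset.sum_eq_zero fun j _ => timeToComplete_eq_zero _ (le_min le_rfl (hp j))
  | (k, q) :: S, t, hq, hS => by
    have := fun j => (hD j).isProb
    rw [List.forall_mem_cons] at hq
    have ih := lintegral_timeToComplete hD S (Function.update t k (t k + q)) hq.2 fun j => by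
      rw [update_add_plannedTotal]
      exact hS j
    have hmeas : ∀ j, Measurable fun p : Fin n → ℝ =>
        (Ioi (t j)).indicator (1 : ℝ → ℝ≥0∞) (p j) *
          ENNReal.ofReal (min (p k) (t k + q) - min (p k) (t k)) := fun j =>
      ((measurable_one.indicator measurableSet_Ioi).comp (measurable_pi_apply j)).mul
        (by fun_prop)
    have hΔ : 0 ≤ trunc (D k) (t k + q) - trunc (D k) (t k) :=
      sub_nonneg.2 ((hD k).trunc_mono (by linarith [hq.1]))
    simp_rw [timeToComplete_cons_min hq.1, Finset.sum_add_distrib]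
    rw [lintegral_add_left (Finset.measurable_sum _ fun j _ => hmeas j), ih,
      lintegral_finsetSum _ fun j _ => hmeas j]
    simp_rw [lintegral_indicator_mul_min_sub hD t _ k hq.1]
    rw [← ENNReal.ofReal_sum_of_nonneg, ← ENNReal.ofReal_add _ (planCost_nonneg hD _ _ hq.2),
      planCost]
    · congr 2
      rw [← Finset.sum_mul, mul_comm, ← Finset.add_sum_erase _ _ (Finset.mem_univ k), if_pos rfl]
      congr 2
      exact Finset.sum_congr rfl fun j hj => if_neg (Finset.ne_of_mem_erase hj)
    · refine Finset.sum_nonneg fun j _ => mul_nonneg ?_ hΔ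
      split_ifs
      exacts [zero_le_one, surv_nonneg _ _]
    · intro j _
      refine mul_nonneg ?_ hΔ
      split_ifs
      exacts [zero_le_one, surv_nonneg _ _]

theorem expectedCost_eq_ofReal_planCost (hD : ∀ j, IsSizeDist (D j)) {S : List (Fin n × ℝ)}
    (hS : ∀ a ∈ S, 0 ≤ a.2) (hcomp : ∀ j, surv (D j) (plannedTotal S j) = 0) :
    expectedCost D S = ENNReal.ofReal (planCost D S fun _ => 0) := by
  have := fun j => (hD j).isProb
  rw [← lintegral_timeToComplete hD S (fun _ => 0) hS (by simpa using hcomp)]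
  refine lintegral_congr_ae ?_
  have h : ∀ᵐ p ∂(Measure.pi D), ∀ j, 0 ≤ p j := by
    rw [ae_all_iff]
    intro j
    exact (measurePreserving_eval D j).quasiMeasurePreserving.ae (hD j).ae_nonneg
  filter_upwards [h] with p hp
  simp only [completionTime, min_eq_right (hp _)]

/-- Stretching all scheduling decisions by `α`, on an `α`-close instance, costs at most
a factor of `α ^ 3`. -/
theorem planCost_stretch_le {α : ℝ} (hα : 1 ≤ α) {D' : Fin n → Measure ℝ}
    (hD : ∀ j, IsSizeDist (D j)) (hD' : ∀ j, IsSizeDist (D' j))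
    (h : ∀ j, AlphaClose α (D j) (D' j)) :
    ∀ (S : List (Fin n × ℝ)) (t : Fin n → ℝ), (∀ a ∈ S, 0 ≤ a.2) → (∀ j, 0 ≤ t j) →
      planCost D (S.map fun a => (a.1, α * a.2)) (fun j => α * t j) ≤ α ^ 3 * planCost D' S t
  | [], _, _, _ => by simp [planCost]
  | (k, q) :: S, t, hS, ht => by
    rw [List.forall_mem_cons] at hS
    have hq : 0 ≤ q := hS.1
    have htk : t k ≤ t k + q := by linarith
    have ih := planCost_stretch_le hα hD hD' h S (Function.update t k (t k + q)) hS.2 fun j => by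
      rcases eq_or_ne j k with rfl | hj
      · simpa using add_nonneg (ht j) hq
      · simpa [hj] using ht j
    have hu : (fun j => α * Function.update t k (t k + q) j) =
        Function.update (fun j => α * t j) k (α * t k + α * q) := by
      funext j
      rcases eq_or_ne j k with rfl | hj
      · simp [mul_add]
      · simp [hj]
    rw [hu] at ih
    -- The work increment contributes `α ^ 2`, the weight `α`; in the weight, the summand `1` of the
    -- running job is absorbed by `1 ≤ α`.
    have h1 := (h k).trunc_sub_le hα (hD k) (hD' k) (ht k) htk
    have h2 : 1 + ∑ j ∈ Finset.univ.erase k, surv (D j) (α * t j) ≤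
        α * (1 + ∑ j ∈ Finset.univ.erase k, surv (D' j) (t j)) := by
      rw [mul_add, mul_one, Finset.mul_sum]
      exact add_le_add hα (Finset.sum_le_sum fun j _ => (h j).surv_le hα (ht j))
    have h3 := mul_le_mul h1 h2
      (add_nonneg zero_le_one (Finset.sum_nonneg fun _ _ => surv_nonneg _ _))
      (mul_nonneg (by positivity) (sub_nonneg.2 ((hD' k).trunc_mono htk)))
    simp only [List.map_cons, planCost]
    rw [mul_add α] at h3
    linarith

end Schedules

/-! ### Gittins quanta of a single job. -/

section SingleJob

variable {D : Measure ℝ} {q : List ℝ}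

lemma attained_zero (q : List ℝ) : attained q 0 = 0 := by simp [attained]

lemma attained_length (q : List ℝ) : attained q q.length = q.sum := by simp [attained]

lemma attained_succ {i : ℕ} (hi : i < q.length) :
    attained q (i + 1) = attained q i + q.getD i 0 := by
  rw [attained, attained, List.sum_take_succ _ _ hi, List.getD_eq_getElem _ _ hi]

lemma IsGittinsQuanta.getD_nonneg (hq : IsGittinsQuanta D q) (i : ℕ) : 0 ≤ q.getD i 0 := by
  rcases lt_or_ge i q.length with hi | hi
  · rw [List.getD_eq_getElem _ _ hi]
    exact (hq.pos _ (List.getElem_mem hi)).le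
  · rw [List.getD_eq_default _ _ hi]

lemma IsGittinsQuanta.attained_lt_succ (hq : IsGittinsQuanta D q) {i : ℕ} (hi : i < q.length) :
    attained q i < attained q (i + 1) := by
  rw [attained_succ hi, List.getD_eq_getElem _ _ hi]
  linarith [hq.pos _ (List.getElem_mem hi)]

lemma IsGittinsQuanta.attained_mono (hq : IsGittinsQuanta D q) : Monotone (attained q) := by
  refine monotone_nat_of_le_succ fun i => ?_
  rcases lt_or_ge i q.length with hi | hi
  · exact (hq.attained_lt_succ hi).le
  · rw [attained, attained, List.take_of_length_le hi, List.take_of_length_le (by omega)]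

lemma IsGittinsQuanta.attained_nonneg (hq : IsGittinsQuanta D q) (i : ℕ) : 0 ≤ attained q i :=
  (attained_zero q).symm.trans_le (hq.attained_mono (Nat.zero_le i))

lemma IsGittinsQuanta.attained_le_sum (hq : IsGittinsQuanta D q) {i : ℕ} (hi : i ≤ q.length) :
    attained q i ≤ q.sum :=
  (hq.attained_mono hi).trans_eq (attained_length q)

lemma IsGittinsQuanta.surv_sum (hq : IsGittinsQuanta D q) (hD : IsSizeDist D) :
    surv D q.sum = 0 := by
  have := hD.isProb
  obtain ⟨s, hs, hs0⟩ := hD.exists_atoms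
  rw [surv, measureReal_eq_zero_iff]
  refine measure_mono_null (t := (s : Set ℝ)ᶜ) (fun x hx hxs => ?_) hs0
  exact (not_le.2 (show q.sum < x from hx)) (hq.total.2 ((hs x).1 hxs))

lemma IsGittinsQuanta.surv_ne_zero (hq : IsGittinsQuanta D q) (hD : IsSizeDist D) {t : ℝ}
    (ht : t < q.sum) : surv D t ≠ 0 := by
  have := hD.isProb
  rw [surv, Ne, measureReal_eq_zero_iff]
  exact fun h => hq.total.1 (measure_mono_null (singleton_subset_iff.2 ht) h)

/-- Rank of the `i`-th quantum. -/
def indexRank (D : Measure ℝ) (q : List ℝ) (i : ℕ) : ℝ := rank D (q.getD i 0) (attained q i)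

/-- Expected work left in the `i`-th quantum when the job has been run up to attained
processing `t`. -/
def quantumLeft (D : Measure ℝ) (q : List ℝ) (i : ℕ) (t : ℝ) : ℝ :=
  trunc D (max t (attained q (i + 1))) - trunc D (max t (attained q i))

namespace IsGittinsQuanta

variable {i : ℕ} {s t : ℝ}

lemma surv_attained_ne_zero (hq : IsGittinsQuanta D q) (hD : IsSizeDist D) (hi : i < q.length) :
    surv D (attained q i) ≠ 0 :=
  hq.surv_ne_zero hD ((hq.attained_lt_succ hi).trans_le (hq.attained_le_sum hi))

lemma surv_attained_sub (hq : IsGittinsQuanta D q) (hD : IsSizeDist D) (hi : i < q.length) :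
    surv D (attained q i) - surv D (attained q (i + 1)) =
      indexRank D q i * (trunc D (attained q (i + 1)) - trunc D (attained q i)) := by
  have h := hD.trunc_lt (hq.attained_lt_succ hi) (hq.surv_attained_ne_zero hD hi)
  rw [indexRank, hD.rank_eq (hq.getD_nonneg i) (hq.surv_attained_ne_zero hD hi),
    ← attained_succ hi, div_mul_cancel₀ _ (sub_pos.2 h).ne']

/-- Maximality of the quantum, tested against the length `t - attained q i`. -/
lemma surv_attained_sub_le (hq : IsGittinsQuanta D q) (hD : IsSizeDist D) (hi : i < q.length)
    (ht : attained q i ≤ t) :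
    surv D (attained q i) - surv D t ≤
      indexRank D q i * (trunc D t - trunc D (attained q i)) := by
  rcases ht.eq_or_lt with rfl | ht
  · simp
  have h0 := hq.surv_attained_ne_zero hD hi
  have h := hD.trunc_lt ht h0
  have hmax := hq.argmax i hi (t - attained q i) (sub_nonneg.2 ht.le)
  rw [hD.rank_eq (sub_nonneg.2 ht.le) h0, add_sub_cancel, div_le_iff₀ (sub_pos.2 h)] at hmax
  rwa [indexRank, List.getD_eq_getElem _ _ hi]

lemma indexRank_nonneg (hq : IsGittinsQuanta D q) (hD : IsSizeDist D) (hi : i < q.length) :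
    0 ≤ indexRank D q i := by
  have h := hD.trunc_lt (hq.attained_lt_succ hi) (hq.surv_attained_ne_zero hD hi)
  have h1 := hD.surv_antitone (hq.attained_lt_succ hi).le
  rw [indexRank, hD.rank_eq (hq.getD_nonneg i) (hq.surv_attained_ne_zero hD hi),
    ← attained_succ hi]
  exact div_nonneg (sub_nonneg.2 h1) (sub_pos.2 h).le

/-- If the next quantum had larger rank, the two quanta merged would have larger rank than the first
one alone; `h3` is maximality against the merged quantum. -/
lemma indexRank_succ_le (hq : IsGittinsQuanta D q) (hD : IsSizeDist D)
    (hi : i + 1 < q.length) : indexRank D q (i + 1) ≤ indexRank D q i := by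
  have h := hD.trunc_lt (hq.attained_lt_succ hi) (hq.surv_attained_ne_zero hD hi)
  have h1 := hq.surv_attained_sub hD (by omega : i < q.length)
  have h2 := hq.surv_attained_sub hD hi
  have h3 := hq.surv_attained_sub_le hD (by omega : i < q.length)
    (hq.attained_mono (by omega : i ≤ i + 1 + 1))
  refine le_of_mul_le_mul_right ?_ (sub_pos.2 h)
  linarith

lemma indexRank_le (hq : IsGittinsQuanta D q) (hD : IsSizeDist D) {i' : ℕ} (hii : i ≤ i')
    (hi' : i' < q.length) : indexRank D q i' ≤ indexRank D q i := by
  induction i', hii using Nat.le_induction with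
  | base => rfl
  | succ m _ ih => exact (hq.indexRank_succ_le hD hi').trans (ih (by omega))

lemma quantumLeft_of_le (hq : IsGittinsQuanta D q) (ht : t ≤ attained q i) :
    quantumLeft D q i t = trunc D (attained q (i + 1)) - trunc D (attained q i) := by
  rw [quantumLeft, max_eq_right ht, max_eq_right (ht.trans (hq.attained_mono i.le_succ))]

lemma quantumLeft_of_ge (hq : IsGittinsQuanta D q) (ht : attained q (i + 1) ≤ t) :
    quantumLeft D q i t = 0 := by
  rw [quantumLeft, max_eq_left ht, max_eq_left ((hq.attained_mono i.le_succ).trans ht), sub_self]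

lemma quantumLeft_nonneg (hq : IsGittinsQuanta D q) (hD : IsSizeDist D) (i : ℕ) (t : ℝ) :
    0 ≤ quantumLeft D q i t :=
  sub_nonneg.2 (hD.trunc_mono (max_le_max le_rfl (hq.attained_mono i.le_succ)))

lemma quantumLeft_antitone (hq : IsGittinsQuanta D q) (hD : IsSizeDist D) (i : ℕ) :
    Antitone (quantumLeft D q i) := by
  intro s t hst
  rcases le_total t (attained q (i + 1)) with h | h
  · rw [quantumLeft, quantumLeft, max_eq_right h, max_eq_right (hst.trans h)]
    exact sub_le_sub_left (hD.trunc_mono (max_le_max hst le_rfl)) _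
  · rw [hq.quantumLeft_of_ge h]
    exact hq.quantumLeft_nonneg hD i s

/-- When `t` lies inside the quantum, the part already run completes the job at a rate of at most
the rank, and the whole quantum at exactly the rank. The remaining part therefore has at least that
rate. -/
lemma indexRank_mul_quantumLeft_le (hq : IsGittinsQuanta D q) (hD : IsSizeDist D)
    (hi : i < q.length) (t : ℝ) :
    indexRank D q i * quantumLeft D q i t ≤
      surv D (max t (attained q i)) - surv D (max t (attained q (i + 1))) := by
  rcases le_total t (attained q i) with h | h
  · rw [hq.quantumLeft_of_le h, max_eq_right h,
      max_eq_right (h.trans (hq.attained_mono i.le_succ)), hq.surv_attained_sub hD hi]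
  rcases le_total t (attained q (i + 1)) with h' | h'
  · rw [quantumLeft, max_eq_left h, max_eq_right h']
    have h1 := hq.surv_attained_sub hD hi
    have h2 := hq.surv_attained_sub_le hD hi h
    linarith
  · rw [hq.quantumLeft_of_ge h', max_eq_left h, max_eq_left h', mul_zero, sub_self]

lemma sum_indexRank_mul_quantumLeft_le (hq : IsGittinsQuanta D q) (hD : IsSizeDist D)
    (ht : 0 ≤ t) :
    ∑ i ∈ Finset.range q.length, indexRank D q i * quantumLeft D q i t ≤ surv D t := by
  refine (Finset.sum_le_sum fun i hi =>
    hq.indexRank_mul_quantumLeft_le hD (Finset.mem_range.1 hi) t).trans ?_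
  rw [Finset.sum_range_sub' fun i => surv D (max t (attained q i)), attained_zero, max_eq_left ht]
  exact sub_le_self _ (surv_nonneg _ _)

/-- At a quantum boundary no quantum is partially run, so every term is exact and the sum telescopes
down to survival `0` at `q.sum`. -/
lemma surv_attained_eq_sum (hq : IsGittinsQuanta D q) (hD : IsSizeDist D) {c : ℕ}
    (hc : c ≤ q.length) :
    surv D (attained q c) =
      ∑ i ∈ Finset.range q.length, indexRank D q i * quantumLeft D q i (attained q c) := by
  have h : ∀ i ∈ Finset.range q.length,
      indexRank D q i * quantumLeft D q i (attained q c) =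
        surv D (max (attained q c) (attained q i)) -
          surv D (max (attained q c) (attained q (i + 1))) := by
    intro i hi
    rcases le_or_gt c i with h | h
    · have h1 := hq.attained_mono h
      have h2 := hq.attained_mono (h.trans i.le_succ)
      rw [hq.quantumLeft_of_le h1, max_eq_right h1, max_eq_right h2,
        hq.surv_attained_sub hD (Finset.mem_range.1 hi)]
    · have h1 := hq.attained_mono h.le
      have h2 := hq.attained_mono (Nat.succ_le_of_lt h)
      rw [hq.quantumLeft_of_ge h2, max_eq_left h1, max_eq_left h2, mul_zero, sub_self]
  rw [Finset.sum_congr rfl h,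
    Finset.sum_range_sub' fun i => surv D (max (attained q c) (attained q i)), attained_zero,
    max_eq_left (hq.attained_nonneg c), attained_length, max_eq_right (hq.attained_le_sum hc),
    hq.surv_sum hD, sub_zero]

lemma trunc_max_sum (hq : IsGittinsQuanta D q) (hD : IsSizeDist D) (t : ℝ) :
    trunc D (max t q.sum) = trunc D q.sum :=
  hD.trunc_eq_of_surv_eq_zero (le_max_right _ _) (hq.surv_sum hD)

lemma sum_quantumLeft (hq : IsGittinsQuanta D q) (hD : IsSizeDist D) (ht : 0 ≤ t) :
    ∑ i ∈ Finset.range q.length, quantumLeft D q i t = trunc D q.sum - trunc D t := by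
  unfold quantumLeft
  rw [Finset.sum_range_sub fun i => trunc D (max t (attained q i)), attained_zero, max_eq_left ht,
    attained_length, hq.trunc_max_sum hD]

end IsGittinsQuanta

end SingleJob

/-! ### The potential as a lower bound for every completing list. -/

section Potential

variable {n : ℕ} {D : Fin n → Measure ℝ} {Q : Fin n → List ℝ}

/-- Expected time for which one of the jobs `j` and `k` waits for the other one under the
Gittins policy, when they have been run up to attained processing `s` and `t`. -/
def pairLeft (D : Fin n → Measure ℝ) (Q : Fin n → List ℝ) (j k : Fin n) (s t : ℝ) : ℝ :=
  ∑ i ∈ Finset.range (Q j).length, ∑ l ∈ Finset.range (Q k).length,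
    min (indexRank (D j) (Q j) i) (indexRank (D k) (Q k) l) *
      (quantumLeft (D j) (Q j) i s * quantumLeft (D k) (Q k) l t)

/-- Expected cost that the Gittins policy still incurs when job `j` has been run up to attained
processing `t j`. -/
def potential (D : Fin n → Measure ℝ) (Q : Fin n → List ℝ) (t : Fin n → ℝ) : ℝ :=
  ∑ j, (trunc (D j) (Q j).sum - trunc (D j) (t j)) +
    (∑ j, ∑ k ∈ Finset.univ.erase j, pairLeft D Q j k (t j) (t k)) / 2

lemma pairLeft_comm (j k : Fin n) (s t : ℝ) : pairLeft D Q j k s t = pairLeft D Q k j t s := by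
  rw [pairLeft, pairLeft, Finset.sum_comm]
  refine Finset.sum_congr rfl fun _ _ => Finset.sum_congr rfl fun _ _ => ?_
  rw [min_comm, mul_comm (quantumLeft _ _ _ _)]

/-- Only pairs containing `k` change, and each occurs in both orders; the resulting `2` cancels the
halving in `potential`. -/
lemma sum_pair_sub_update {G : Fin n → Fin n → ℝ → ℝ → ℝ}
    (hG : ∀ j k s t, G j k s t = G k j t s) (t : Fin n → ℝ) (k : Fin n) (x : ℝ) :
    ∑ j, ∑ l ∈ Finset.univ.erase j, G j l (t j) (t l) -
      ∑ j, ∑ l ∈ Finset.univ.erase j,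
        G j l (Function.update t k x j) (Function.update t k x l) =
      2 * ∑ j ∈ Finset.univ.erase k, (G j k (t j) (t k) - G j k (t j) x) := by
  simp_rw [← Finset.sum_sub_distrib]
  rw [← Finset.add_sum_erase _ _ (Finset.mem_univ k), two_mul]
  congr 1
  · refine Finset.sum_congr rfl fun l hl => ?_
    rw [Function.update_self, Function.update_of_ne (Finset.ne_of_mem_erase hl), hG k l, hG k l]
  · refine Finset.sum_congr rfl fun j hj => ?_
    have hjk := Finset.ne_of_mem_erase hj
    rw [Finset.sum_eq_single_of_mem k (Finset.mem_erase.2 ⟨hjk.symm, Finset.mem_univ k⟩)]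
    · rw [Function.update_self, Function.update_of_ne hjk]
    · intro l _ hl
      rw [Function.update_of_ne hjk, Function.update_of_ne hl, sub_self]

lemma potential_sub_update (t : Fin n → ℝ) (k : Fin n) (x : ℝ) :
    potential D Q t - potential D Q (Function.update t k x) =
      (trunc (D k) x - trunc (D k) (t k)) +
        ∑ j ∈ Finset.univ.erase k,
          (pairLeft D Q j k (t j) (t k) - pairLeft D Q j k (t j) x) := by
  have h1 := sum_pair_sub_update (G := pairLeft D Q) pairLeft_comm t k x
  have h2 : ∑ j, (trunc (D j) (Q j).sum - trunc (D j) (t j)) -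
      ∑ j, (trunc (D j) (Q j).sum - trunc (D j) (Function.update t k x j)) =
      trunc (D k) x - trunc (D k) (t k) := by
    rw [← Finset.sum_sub_distrib, Finset.sum_eq_single_of_mem k (Finset.mem_univ k)]
    · rw [Function.update_self]
      ring
    · intro j _ hj
      rw [Function.update_of_ne hj, sub_self]
  rw [potential, potential]
  linarith

lemma pairLeft_nonneg (hD : ∀ j, IsSizeDist (D j)) (hQ : ∀ j, IsGittinsQuanta (D j) (Q j))
    (j k : Fin n) (s t : ℝ) : 0 ≤ pairLeft D Q j k s t :=
  Finset.sum_nonneg fun _ hi => Finset.sum_nonneg fun _ hl => mul_nonneg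
    (le_min ((hQ j).indexRank_nonneg (hD j) (Finset.mem_range.1 hi))
      ((hQ k).indexRank_nonneg (hD k) (Finset.mem_range.1 hl)))
    (mul_nonneg ((hQ j).quantumLeft_nonneg (hD j) _ _) ((hQ k).quantumLeft_nonneg (hD k) _ _))

lemma potential_nonneg (hD : ∀ j, IsSizeDist (D j)) (hQ : ∀ j, IsGittinsQuanta (D j) (Q j))
    (t : Fin n → ℝ) : 0 ≤ potential D Q t := by
  refine add_nonneg (Finset.sum_nonneg fun j _ => sub_nonneg.2 ?_)
    (div_nonneg (Finset.sum_nonneg fun j _ => Finset.sum_nonneg fun k _ =>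
      pairLeft_nonneg hD hQ _ _ _ _) zero_le_two)
  exact ((hD j).trunc_mono (le_max_left _ _)).trans_eq ((hQ j).trunc_max_sum (hD j) (t j))

lemma potential_eq_zero (hD : ∀ j, IsSizeDist (D j)) (hQ : ∀ j, IsGittinsQuanta (D j) (Q j))
    {t : Fin n → ℝ} (ht : ∀ j, surv (D j) (t j) = 0) : potential D Q t = 0 := by
  have hsum : ∀ j, (Q j).sum ≤ t j := fun j =>
    not_lt.1 fun h => (hQ j).surv_ne_zero (hD j) h (ht j)
  rw [potential, Finset.sum_eq_zero, Finset.sum_eq_zero, zero_div, add_zero]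
  · refine fun j _ => Finset.sum_eq_zero fun k _ => Finset.sum_eq_zero fun i hi =>
      Finset.sum_eq_zero fun l _ => ?_
    rw [(hQ j).quantumLeft_of_ge
      (((hQ j).attained_le_sum (Finset.mem_range.1 hi)).trans (hsum j)), zero_mul, mul_zero]
  · intro j _
    rw [(hD j).trunc_eq_of_surv_eq_zero (hsum j) ((hQ j).surv_sum (hD j)), sub_self]

lemma pairLeft_sub (j k : Fin n) (s t x : ℝ) :
    pairLeft D Q j k s t - pairLeft D Q j k s x =
      ∑ i ∈ Finset.range (Q j).length, ∑ l ∈ Finset.range (Q k).length,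
        min (indexRank (D j) (Q j) i) (indexRank (D k) (Q k) l) *
          (quantumLeft (D j) (Q j) i s *
            (quantumLeft (D k) (Q k) l t - quantumLeft (D k) (Q k) l x)) := by
  simp_rw [pairLeft, ← Finset.sum_sub_distrib, mul_sub]

lemma pairLeft_sub_le (hD : ∀ j, IsSizeDist (D j)) (hQ : ∀ j, IsGittinsQuanta (D j) (Q j))
    (j k : Fin n) {s t x : ℝ} (hs : 0 ≤ s) (ht : 0 ≤ t) (htx : t ≤ x) :
    pairLeft D Q j k s t - pairLeft D Q j k s x ≤
      (trunc (D k) x - trunc (D k) t) * surv (D j) s := by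
  have h2 : ∑ l ∈ Finset.range (Q k).length,
      (quantumLeft (D k) (Q k) l t - quantumLeft (D k) (Q k) l x) =
        trunc (D k) x - trunc (D k) t := by
    rw [Finset.sum_sub_distrib, (hQ k).sum_quantumLeft (hD k) ht,
      (hQ k).sum_quantumLeft (hD k) (ht.trans htx)]
    ring
  refine le_trans ?_ (mul_le_mul_of_nonneg_left
    ((hQ j).sum_indexRank_mul_quantumLeft_le (hD j) hs)
    (sub_nonneg.2 ((hD k).trunc_mono htx)))
  -- Once the minimum is replaced by the rank of the quantum of `j`, the double sum is a product.
  rw [pairLeft_sub, mul_comm, ← h2, Finset.sum_mul_sum]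
  refine Finset.sum_le_sum fun i _ => Finset.sum_le_sum fun l _ => ?_
  rw [mul_assoc]
  exact mul_le_mul_of_nonneg_right (min_le_left _ _)
    (mul_nonneg ((hQ j).quantumLeft_nonneg (hD j) _ _)
      (sub_nonneg.2 ((hQ k).quantumLeft_antitone (hD k) _ htx)))

/-- Every sequence of scheduling decisions that completes all jobs costs at least the
potential. -/
theorem potential_le_planCost (hD : ∀ j, IsSizeDist (D j))
    (hQ : ∀ j, IsGittinsQuanta (D j) (Q j)) :
    ∀ (S : List (Fin n × ℝ)) (t : Fin n → ℝ), (∀ a ∈ S, 0 ≤ a.2) → (∀ j, 0 ≤ t j) →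
      (∀ j, surv (D j) (t j + plannedTotal S j) = 0) → potential D Q t ≤ planCost D S t
  | [], t, _, _, hS => (potential_eq_zero hD hQ (by simpa [plannedTotal] using hS)).le
  | (k, q) :: S, t, hq, ht, hS => by
    rw [List.forall_mem_cons] at hq
    have hq0 : 0 ≤ q := hq.1
    have htk : t k ≤ t k + q := by linarith
    have ih := potential_le_planCost hD hQ S (Function.update t k (t k + q)) hq.2
      (fun j => by
        rcases eq_or_ne j k with rfl | hj
        · simpa using add_nonneg (ht j) hq0
        · simpa [hj] using ht j)
      (fun j => by
        rw [update_add_plannedTotal]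
        exact hS j)
    have h := potential_sub_update (D := D) (Q := Q) t k (t k + q)
    have hle := Finset.sum_le_sum fun j (_ : j ∈ Finset.univ.erase k) =>
      pairLeft_sub_le hD hQ j k (ht j) (ht k) htk
    rw [← Finset.mul_sum] at hle
    rw [planCost, mul_add, mul_one]
    linarith

end Potential

/-! ### The GIPP order attains the potential. -/

section Gipp

variable {n : ℕ} {D : Fin n → Measure ℝ} {Q : Fin n → List ℝ}

/-- Running the next quantum `c k` of job `k` decreases the potential by at least its
contribution to the cost, if its rank is at least that of all quanta left of the other jobs. -/
lemma surv_mul_le_pairLeft_sub (hD : ∀ j, IsSizeDist (D j))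
    (hQ : ∀ j, IsGittinsQuanta (D j) (Q j)) (j k : Fin n) {c c' : ℕ} (hc : c ≤ (Q j).length)
    (hc' : c' < (Q k).length)
    (hrank : ∀ i, c ≤ i → i < (Q j).length →
      indexRank (D j) (Q j) i ≤ indexRank (D k) (Q k) c') :
    (trunc (D k) (attained (Q k) (c' + 1)) - trunc (D k) (attained (Q k) c')) *
        surv (D j) (attained (Q j) c) ≤
      pairLeft D Q j k (attained (Q j) c) (attained (Q k) c') -
        pairLeft D Q j k (attained (Q j) c) (attained (Q k) (c' + 1)) := by
  rw [(hQ j).surv_attained_eq_sum (hD j) hc, pairLeft_sub, Finset.mul_sum]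
  refine Finset.sum_le_sum fun i hi => ?_
  have hmono := (hQ k).attained_mono c'.le_succ
  -- Only the quantum `c'` of job `k` is kept; the other summands are nonnegative.
  refine le_trans ?_ (Finset.single_le_sum (f := fun l =>
    min (indexRank (D j) (Q j) i) (indexRank (D k) (Q k) l) *
      (quantumLeft (D j) (Q j) i (attained (Q j) c) *
        (quantumLeft (D k) (Q k) l (attained (Q k) c') -
          quantumLeft (D k) (Q k) l (attained (Q k) (c' + 1))))) (fun l hl => mul_nonneg
    (le_min ((hQ j).indexRank_nonneg (hD j) (Finset.mem_range.1 hi))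
      ((hQ k).indexRank_nonneg (hD k) (Finset.mem_range.1 hl)))
    (mul_nonneg ((hQ j).quantumLeft_nonneg (hD j) _ _)
      (sub_nonneg.2 ((hQ k).quantumLeft_antitone (hD k) _ hmono)))) (Finset.mem_range.2 hc'))
  rw [(hQ k).quantumLeft_of_le le_rfl, (hQ k).quantumLeft_of_ge le_rfl, sub_zero]
  rcases lt_or_ge i c with h | h
  · rw [(hQ j).quantumLeft_of_ge ((hQ j).attained_mono h)]
    simp
  · rw [min_eq_left (hrank i h (Finset.mem_range.1 hi))]
    exact le_of_eq (by ring)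

/-- The GIPP order costs at most the potential. -/
theorem planCost_le_potential (hD : ∀ j, IsSizeDist (D j))
    (hQ : ∀ j, IsGittinsQuanta (D j) (Q j)) :
    ∀ (L : List (Fin n × ℕ)) (c : Fin n → ℕ), (∀ j, c j ≤ (Q j).length) →
      L.Pairwise (gippLE D Q) → L.Nodup →
      (∀ a, a ∈ L ↔ c a.1 ≤ a.2 ∧ a.2 < (Q a.1).length) →
      planCost D (L.map fun a => (a.1, quantumLength Q a)) (fun j => attained (Q j) (c j)) ≤
        potential D Q fun j => attained (Q j) (c j)
  | [], _, _, _, _, _ => potential_nonneg hD hQ _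
  | (k, i) :: L, c, hc, hsort, hnd, hmem => by
    rw [List.pairwise_cons] at hsort
    rw [List.nodup_cons] at hnd
    obtain ⟨hki, hik⟩ := (hmem (k, i)).1 List.mem_cons_self
    dsimp only at hki hik
    have hck : c k < (Q k).length := hki.trans_lt hik
    -- Otherwise the quantum `c k` would come later in the list, although its rank is at least as
    -- large and ties within a job favor the smaller index.
    have hi : i = c k := by
      by_contra hne
      have hin : (k, c k) ∈ L :=
        (List.mem_cons.1 ((hmem (k, c k)).2 ⟨le_rfl, hck⟩)).resolve_left
          fun h => hne (Prod.mk.inj h).2.symm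
      rcases hsort.1 _ hin with h | ⟨_, h⟩
      · exact absurd ((hQ k).indexRank_le (hD k) hki hik) (not_le.2 h)
      · rcases h with h | ⟨_, h⟩
        · exact absurd h (lt_irrefl _)
        · exact hne (le_antisymm h hki)
    subst hi
    have hrank : ∀ a ∈ L, indexRank (D a.1) (Q a.1) a.2 ≤ indexRank (D k) (Q k) (c k) := by
      intro a ha
      rcases hsort.1 a ha with h | ⟨h, _⟩
      · exact h.le
      · exact h.ge
    have hu : Function.update (fun j => attained (Q j) (c j)) k
        (attained (Q k) (c k) + quantumLength Q (k, c k)) =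
        fun j => attained (Q j) (Function.update c k (c k + 1) j) := by
      funext j
      rcases eq_or_ne j k with rfl | hj
      · rw [Function.update_self, Function.update_self, attained_succ hck]
        rfl
      · rw [Function.update_of_ne hj, Function.update_of_ne hj]
    have ih := planCost_le_potential hD hQ L (Function.update c k (c k + 1))
      (fun j => by
        rcases eq_or_ne j k with rfl | hj
        · rw [Function.update_self]
          exact hck
        · rw [Function.update_of_ne hj]
          exact hc j)
      hsort.2 hnd.2
      (fun a => by
        obtain ⟨j, l⟩ := a
        have h := hmem (j, l)
        rw [List.mem_cons] at h
        rcases eq_or_ne j k with rfl | hj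
        · simp only [Function.update_self]
          rcases eq_or_ne l (c j) with rfl | hl
          · exact ⟨fun h' => absurd h' hnd.1, fun h' => absurd h'.1 (by omega)⟩
          · have : (j, l) ≠ (j, c j) := fun e => hl (Prod.mk.inj e).2
            simp only [this, false_or] at h
            rw [h]
            omega
        · have : (j, l) ≠ (k, c k) := fun e => hj (Prod.mk.inj e).1
          simpa only [this, false_or, Function.update_of_ne hj] using h)
    have hatt : attained (Q k) (c k) + quantumLength Q (k, c k) = attained (Q k) (c k + 1) :=
      (attained_succ hck).symm
    have h := potential_sub_update (D := D) (Q := Q) (fun j => attained (Q j) (c j)) k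
      (attained (Q k) (c k + 1))
    rw [← hu, hatt] at ih
    -- Every quantum left of another job is in the tail `L`, so its rank is at most that of the
    -- head.
    have hle := Finset.sum_le_sum fun j (hj : j ∈ Finset.univ.erase k) =>
      surv_mul_le_pairLeft_sub hD hQ j k (hc j) hck fun i h1 h2 =>
        hrank (j, i) ((List.mem_cons.1 ((hmem (j, i)).2 ⟨h1, h2⟩)).resolve_left
          fun e => Finset.ne_of_mem_erase hj (Prod.mk.inj e).1)
    rw [← Finset.mul_sum] at hle
    rw [List.map_cons, planCost, hatt, mul_add, mul_one]
    dsimp only at h ⊢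
    linarith

end Gipp

/-! ### Properties of the GIPP list and the chain of comparisons. -/

section Main

variable {n : ℕ} {D : Fin n → Measure ℝ} {Q : Fin n → List ℝ}

lemma gippLE_total (D : Fin n → Measure ℝ) (Q : Fin n → List ℝ) (a b : Fin n × ℕ) :
    gippLE D Q a b ∨ gippLE D Q b a := by
  unfold gippLE
  rcases lt_trichotomy (quantumRank D Q a) (quantumRank D Q b) with h | h | h
  · exact Or.inr (Or.inl h)
  · rcases lt_trichotomy a.1 b.1 with h' | h' | h'
    · exact Or.inl (Or.inr ⟨h, Or.inl h'⟩)
    · rcases le_total a.2 b.2 with h'' | h''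
      · exact Or.inl (Or.inr ⟨h, Or.inr ⟨h', h''⟩⟩)
      · exact Or.inr (Or.inr ⟨h.symm, Or.inr ⟨h'.symm, h''⟩⟩)
    · exact Or.inr (Or.inr ⟨h.symm, Or.inl h'⟩)
  · exact Or.inl (Or.inl h)

lemma gippLE_trans {a b c : Fin n × ℕ} (hab : gippLE D Q a b) (hbc : gippLE D Q b c) :
    gippLE D Q a c := by
  rcases hab with h | ⟨h, h'⟩ <;> rcases hbc with g | ⟨g, g'⟩
  · exact Or.inl (g.trans h)
  · exact Or.inl (g ▸ h)
  · exact Or.inl (h ▸ g)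
  · refine Or.inr ⟨h.trans g, ?_⟩
    rcases h' with h' | ⟨h', h''⟩ <;> rcases g' with g' | ⟨g', g''⟩
    · exact Or.inl (h'.trans g')
    · exact Or.inl (g' ▸ h')
    · exact Or.inl (h' ▸ g')
    · exact Or.inr ⟨h'.trans g', h''.trans g''⟩

lemma pairwise_gippOrder (D : Fin n → Measure ℝ) (Q : Fin n → List ℝ) :
    (gippOrder D Q).Pairwise (gippLE D Q) := by
  classical
  have : Std.Total (gippLE D Q) := ⟨gippLE_total D Q⟩
  have : IsTrans _ (gippLE D Q) := ⟨fun _ _ _ => gippLE_trans⟩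
  exact List.pairwise_insertionSort _ _

lemma gippOrder_perm (D : Fin n → Measure ℝ) (Q : Fin n → List ℝ) :
    (gippOrder D Q).Perm (quantaIndices Q) := by
  classical
  exact List.perm_insertionSort _ _

lemma mem_gippOrder (D : Fin n → Measure ℝ) (Q : Fin n → List ℝ) (a : Fin n × ℕ) :
    a ∈ gippOrder D Q ↔ a.2 < (Q a.1).length := by
  rw [(gippOrder_perm D Q).mem_iff, quantaIndices]
  obtain ⟨j, i⟩ := a
  simp

lemma nodup_gippOrder (D : Fin n → Measure ℝ) (Q : Fin n → List ℝ) : (gippOrder D Q).Nodup := by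
  rw [(gippOrder_perm D Q).nodup_iff, quantaIndices, List.nodup_flatMap]
  refine ⟨fun j _ => List.nodup_range.map fun _ _ h => (Prod.mk.inj h).2,
    (List.nodup_finRange n).imp fun {j k} hjk => ?_⟩
  rw [Function.onFun, List.disjoint_left]
  intro a ha ha'
  simp only [List.mem_map] at ha ha'
  obtain ⟨_, _, rfl⟩ := ha
  obtain ⟨_, _, h⟩ := ha'
  exact hjk (Prod.mk.inj h).1.symm

lemma sum_map_getD_range (q : List ℝ) :
    ((List.range q.length).map fun i => q.getD i 0).sum = q.sum := by
  congr 1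
  refine List.ext_getElem (by simp) fun i h1 h2 => ?_
  simp [List.getElem?_eq_getElem h2]

lemma plannedTotal_gippSchedule (c : ℝ) (D : Fin n → Measure ℝ) (Q : Fin n → List ℝ)
    (j : Fin n) : plannedTotal (gippSchedule c D Q) j = c * (Q j).sum := by
  have h : ∀ k : Fin n, ((List.range (Q k).length).map fun i =>
      if k = j then c * quantumLength Q (k, i) else 0).sum =
        if k = j then c * (Q j).sum else 0 := by
    intro k
    split_ifs with hk
    · subst hk
      rw [List.sum_map_mul_left, ← sum_map_getD_range (Q k)]
      rfl
    · simp
  rw [plannedTotal, gippSchedule, List.map_map, ((gippOrder_perm D Q).map _).sum_eq,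
    quantaIndices, List.map_flatMap, List.flatMap, List.sum_flatten, List.map_map]
  simp only [Function.comp_def, List.map_map, h]
  rw [← List.ofFn_eq_map, List.sum_ofFn]
  simp

lemma nonneg_of_mem_gippSchedule (hQ : ∀ j, IsGittinsQuanta (D j) (Q j)) {c : ℝ} (hc : 0 ≤ c) :
    ∀ a ∈ gippSchedule c D Q, 0 ≤ a.2 := by
  intro a ha
  obtain ⟨b, _, rfl⟩ := List.mem_map.1 ha
  exact mul_nonneg hc ((hQ b.1).getD_nonneg b.2)

lemma gippSchedule_eq_map (c : ℝ) (D : Fin n → Measure ℝ) (Q : Fin n → List ℝ) :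
    gippSchedule c D Q = (gippSchedule 1 D Q).map fun a => (a.1, c * a.2) := by
  simp [gippSchedule, Function.comp_def]

/-- The Gittins policy is optimal among the sequences of scheduling decisions that complete
all jobs. -/
theorem planCost_gippSchedule_le (hD : ∀ j, IsSizeDist (D j))
    (hQ : ∀ j, IsGittinsQuanta (D j) (Q j)) {S : List (Fin n × ℝ)} (hS : ∀ a ∈ S, 0 ≤ a.2)
    (hcomp : ∀ j, surv (D j) (plannedTotal S j) = 0) :
    planCost D (gippSchedule 1 D Q) (fun _ => 0) ≤ planCost D S fun _ => 0 := by
  have h1 := planCost_le_potential hD hQ (gippOrder D Q) (fun _ => 0) (fun j => Nat.zero_le _)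
    (pairwise_gippOrder D Q) (nodup_gippOrder D Q) (fun a => by simp [mem_gippOrder])
  simp only [attained_zero] at h1
  have h2 := potential_le_planCost hD hQ S (fun _ => 0) hS (fun _ => le_rfl) (by simpa using hcomp)
  simp only [gippSchedule, one_mul]
  exact h1.trans h2

/-- The stretched Gittins schedule of an `α`-close instance completes all jobs, at a cost of at
most `α ^ 3` times that of the Gittins schedule on its own instance. -/
theorem planCost_gippSchedule_stretch_le {α : ℝ} (hα : 1 ≤ α) {D' : Fin n → Measure ℝ}
    (hD : ∀ j, IsSizeDist (D j)) (hD' : ∀ j, IsSizeDist (D' j))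
    (h : ∀ j, AlphaClose α (D j) (D' j)) (hQ : ∀ j, IsGittinsQuanta (D' j) (Q j)) :
    planCost D (gippSchedule α D' Q) (fun _ => 0) ≤
      α ^ 3 * planCost D' (gippSchedule 1 D' Q) fun _ => 0 := by
  have := planCost_stretch_le hα hD hD' h (gippSchedule 1 D' Q) (fun _ => 0)
    (nonneg_of_mem_gippSchedule hQ zero_le_one) fun _ => le_rfl
  rw [gippSchedule_eq_map α]
  simpa only [mul_zero] using this

/-- By closeness, zero survival at the total of the quanta for `D'` forces zero survival at `α`
times that total for `D`. -/
lemma surv_plannedTotal_gippSchedule {α : ℝ} (hα : 1 ≤ α) {D' : Fin n → Measure ℝ}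
    (hD' : ∀ j, IsSizeDist (D' j)) (h : ∀ j, AlphaClose α (D j) (D' j))
    (hQ : ∀ j, IsGittinsQuanta (D' j) (Q j)) (j : Fin n) :
    surv (D j) (plannedTotal (gippSchedule α D' Q) j) = 0 := by
  have h0 : 0 ≤ (Q j).sum := List.sum_nonneg fun x hx => ((hQ j).pos x hx).le
  rw [plannedTotal_gippSchedule]
  refine le_antisymm (((h j).surv_le hα h0).trans_eq ?_) (surv_nonneg _ _)
  rw [(hQ j).surv_sum (hD' j), mul_zero]

end Main

end RobustGittins

end

open RobustGittins in
theorem theorem3 (n : ℕ) (α : ℝ) (hα : 1 ≤ α)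
    (Dtrue Dpred : Fin n → MeasureTheory.Measure ℝ)
    (htrue : ∀ j, RobustGittins.IsSizeDist (Dtrue j))
    (hpred : ∀ j, RobustGittins.IsSizeDist (Dpred j))
    (hclose : ∀ j, RobustGittins.AlphaClose α (Dtrue j) (Dpred j))
    (Qtrue Qpred : Fin n → List ℝ)
    (hQtrue : ∀ j, RobustGittins.IsGittinsQuanta (Dtrue j) (Qtrue j))
    (hQpred : ∀ j, RobustGittins.IsGittinsQuanta (Dpred j) (Qpred j)) :
    RobustGittins.RG α Dtrue Dpred Qpred
      ≤ ENNReal.ofReal α ^ 6 * RobustGittins.GIPP Dtrue Dtrue Qtrue := by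
  have h0 : 0 ≤ α := by linarith
  have hsymm := fun j => (hclose j).symm hα
  have hself : ∀ j, surv (Dtrue j) (plannedTotal (gippSchedule 1 Dtrue Qtrue) j) = 0 := by
    intro j
    rw [plannedTotal_gippSchedule, one_mul, (hQtrue j).surv_sum (htrue j)]
  rw [RG, GIPP, expectedCost_eq_ofReal_planCost htrue (nonneg_of_mem_gippSchedule hQpred h0)
      (surv_plannedTotal_gippSchedule hα hpred hclose hQpred),
    expectedCost_eq_ofReal_planCost htrue (nonneg_of_mem_gippSchedule hQtrue zero_le_one) hself,
    ← ENNReal.ofReal_pow h0, ← ENNReal.ofReal_mul (by positivity)]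
  refine ENNReal.ofReal_le_ofReal ?_
  calc planCost Dtrue (gippSchedule α Dpred Qpred) (fun _ => 0)
      ≤ α ^ 3 * planCost Dpred (gippSchedule 1 Dpred Qpred) (fun _ => 0) :=
        planCost_gippSchedule_stretch_le hα htrue hpred hclose hQpred
    -- The stretched true Gittins list is a valid competitor: by symmetric closeness it completes
    -- all predicted jobs.
    _ ≤ α ^ 3 * planCost Dpred (gippSchedule α Dtrue Qtrue) (fun _ => 0) :=
        mul_le_mul_of_nonneg_left (planCost_gippSchedule_le hpred hQpred
          (nonneg_of_mem_gippSchedule hQtrue h0)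
          (surv_plannedTotal_gippSchedule hα htrue hsymm hQtrue)) (by positivity)
    _ ≤ α ^ 3 * (α ^ 3 * planCost Dtrue (gippSchedule 1 Dtrue Qtrue) (fun _ => 0)) :=
        mul_le_mul_of_nonneg_left
          (planCost_gippSchedule_stretch_le hα hpred htrue hsymm hQtrue) (by positivity)
    _ = α ^ 6 * planCost Dtrue (gippSchedule 1 Dtrue Qtrue) (fun _ => 0) := by ring
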